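/- Let $(M,g)$ be a smooth $(n+1)$-dimensional Lorentzian manifold of signature $(-,+,\dots,+)$ with Levi-Civita connection $\nabla$. A smooth function $f:M\to\mathbb R$ is called a *spacetime convex function* if its Hessian $\nabla_\mu\nabla_\nu f$ has Lorentzian signature at every point and there is a constant $c>0$ such that $V^\mu V^\nu\nabla_\mu\nabla_\nu f\ge c\,g_{\mu\nu}V^\mu V^\nu$ for all $V\in TM$. Suppose that $(M,g)$ admits a spacetime convex function $f$. Let $\Sigma\subset M$ be an embedded spacelike hypersurface with induced (positive definite) metric $h_{ij}$ and Levi-Civita connection $D$ of $h_{ij}$, and let $K_{ij}$ be its second fundamental form, $K(X,Y)=g(t,\nabla_XY)$ for $X,Y$ tangent to $\Sigma$ and $t$ a unit timelike normal ($g(t,t)=-1$). If $\Sigma$ is totally geodesic, i.e. $K_{ij}=0$, then the restriction $\tilde f=f|_\Sigma$ is a convex function on $(\Sigma,h_{ij})$: it is smooth with $D_iD_j\tilde f\ge 0$. Moreover it is strictly convex ($D_iD_j\tilde f>0$), and uniformly convex: there is a constant $\tilde c>0$ such that $V^iV^jD_iD_j\tilde f\ge\tilde c\,h_{ij}V^iV^j$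 for all $V\in T\Sigma$. -/

import Mathlib

set_option maxSynthPendingDepth 3

open scoped Manifold ContDiff

noncomputable section

/-- A continuous bilinear form is a *symmetric form of Lorentzian signature* `(-,+,…,+)`: it is
symmetric, it is negative on some vector `v`, and it is positive definite on the orthogonal
complement of `v`. -/
def IsLorentzianForm {V : Type*} [AddCommGroup V] [Module ℝ V] [TopologicalSpace V]
    (B : V →L[ℝ] V →L[ℝ] ℝ) : Prop :=
  (∀ v w, B v w = B w v) ∧ ∃ v, B v v < 0 ∧ ∀ w, w ≠ 0 → B v w = 0 → 0 < B w w

/-- The pullback `(v, w) ↦ B (L v) (L w)` of a bilinear form `B` by a linear map `L`. -/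
def pullbackForm {V W : Type*} [AddCommGroup V] [Module ℝ V] [TopologicalSpace V]
    [AddCommGroup W] [Module ℝ W] [TopologicalSpace W]
    (B : W →L[ℝ] W →L[ℝ] ℝ) (L : V →L[ℝ] W) : V →L[ℝ] V →L[ℝ] ℝ :=
  ContinuousLinearMap.precomp ℝ L ∘L B ∘L L

theorem pullbackForm_apply {V W : Type*} [AddCommGroup V] [Module ℝ V] [TopologicalSpace V]
    [AddCommGroup W] [Module ℝ W] [TopologicalSpace W]
    (B : W →L[ℝ] W →L[ℝ] ℝ) (L : V →L[ℝ] W) (v w : V) :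
    pullbackForm B L v w = B (L v) (L w) :=
  rfl

/-- A smooth Lorentzian metric on a manifold `M` of dimension `n`. -/
structure LorentzianMetric (n : ℕ) (M : Type*) [TopologicalSpace M]
    [ChartedSpace (EuclideanSpace ℝ (Fin n)) M] [IsManifold (𝓡 n) ∞ M] where
  /-- The scalar product on each tangent space. -/
  inner (x : M) : TangentSpace (𝓡 n) x →L[ℝ] TangentSpace (𝓡 n) x →L[ℝ] ℝ
  lorentzian (x : M) : IsLorentzianForm (inner x)
  contMDiff : ContMDiff (𝓡 n)
    ((𝓡 n).prod 𝓘(ℝ, EuclideanSpace ℝ (Fin n) →L[ℝ] EuclideanSpace ℝ (Fin n) →L[ℝ] ℝ)) ∞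
    (fun x ↦ Bundle.TotalSpace.mk'
      (EuclideanSpace ℝ (Fin n) →L[ℝ] EuclideanSpace ℝ (Fin n) →L[ℝ] ℝ) x (inner x))

/-- The form `(u, v, w) ↦ (D u v w + D v u w - D w u v) / 2`. -/
def koszulForm {E : Type*} [NormedAddCommGroup E] [NormedSpace ℝ E]
    (D : E →L[ℝ] E →L[ℝ] E →L[ℝ] ℝ) : E →L[ℝ] E →L[ℝ] E →L[ℝ] ℝ :=
  (1 / 2 : ℝ) • (D + D.flip -
    (ContinuousLinearMap.flipₗᵢ ℝ E E ℝ).toContinuousLinearEquiv.toContinuousLinearMap ∘L D.flip)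

theorem koszulForm_apply {E : Type*} [NormedAddCommGroup E] [NormedSpace ℝ E]
    (D : E →L[ℝ] E →L[ℝ] E →L[ℝ] ℝ) (u v w : E) :
    koszulForm D u v w = (D u v w + D v u w - D w u v) / 2 := by
  simp [koszulForm]
  ring

section LeviCivita

variable {n : ℕ} {M : Type*} [TopologicalSpace M] [ChartedSpace (EuclideanSpace ℝ (Fin n)) M]
  (g : ∀ x : M, TangentSpace (𝓡 n) x →L[ℝ] TangentSpace (𝓡 n) x →L[ℝ] ℝ)

/-- The components of a covariant 2-tensor field `g` in the chart around `x`, as a function of the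
coordinates `y`: `G(y)(u, v) = g(dφ⁻¹ u, dφ⁻¹ v)` at the point `φ⁻¹ y`, where `φ` is the chart. -/
def coordMetric (x : M) (y : EuclideanSpace ℝ (Fin n)) :
    EuclideanSpace ℝ (Fin n) →L[ℝ] EuclideanSpace ℝ (Fin n) →L[ℝ] ℝ :=
  pullbackForm (V := EuclideanSpace ℝ (Fin n)) (g ((extChartAt (𝓡 n) x).symm y))
    (mfderiv (𝓡 n) (𝓡 n) (extChartAt (𝓡 n) x).symm y)

/-- The Christoffel symbols of the first kind of `g` at `x`, in the chart around `x`: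
`Γ(u, v)(w) = (∂_u G(v, w) + ∂_v G(u, w) - ∂_w G(u, v)) / 2`. -/
def christoffelFirst (x : M) :
    EuclideanSpace ℝ (Fin n) →L[ℝ] EuclideanSpace ℝ (Fin n) →L[ℝ]
      EuclideanSpace ℝ (Fin n) →L[ℝ] ℝ :=
  koszulForm (fderiv ℝ (coordMetric g x) (extChartAt (𝓡 n) x x))

/-- The Christoffel symbols (of the second kind) of the Levi-Civita connection of `g` at `x`, in
the chart around `x`. The index is raised with the inverse of `G`, seen as a map from vectors to
covectors. -/
def christoffel (x : M) :
    EuclideanSpace ℝ (Fin n) →L[ℝ] EuclideanSpace ℝ (Fin n) →L[ℝ] EuclideanSpace ℝ (Fin n) :=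
  ContinuousLinearMap.compL ℝ _ _ _ (coordMetric g x (extChartAt (𝓡 n) x x)).inverse ∘L
    christoffelFirst g x

/-- The Hessian `∇∇f` of a function `f` at `x` with respect to the Levi-Civita connection of `g`.
In the chart around `x`, which identifies the tangent space at `x` with `ℝⁿ`, it is
`∂_u ∂_v f - ∂_{Γ(u, v)} f`. -/
def hessian (f : M → ℝ) (x : M) :
    TangentSpace (𝓡 n) x →L[ℝ] TangentSpace (𝓡 n) x →L[ℝ] ℝ :=
  let F : EuclideanSpace ℝ (Fin n) → ℝ := f ∘ (extChartAt (𝓡 n) x).symm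
  let y := extChartAt (𝓡 n) x x
  (fderiv ℝ (fderiv ℝ F) y - ContinuousLinearMap.compL ℝ _ _ _ (fderiv ℝ F y) ∘L christoffel g x :
    EuclideanSpace ℝ (Fin n) →L[ℝ] EuclideanSpace ℝ (Fin n) →L[ℝ] ℝ)

theorem christoffelFirst_apply (x : M) (u v w : EuclideanSpace ℝ (Fin n)) :
    christoffelFirst g x u v w =
      (fderiv ℝ (coordMetric g x) (extChartAt (𝓡 n) x x) u v w
        + fderiv ℝ (coordMetric g x) (extChartAt (𝓡 n) x x) v u w
        - fderiv ℝ (coordMetric g x) (extChartAt (𝓡 n) x x) w u v) / 2 := by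
  exact koszulForm_apply _ u v w

theorem coordMetric_christoffel (x : M)
    (hg : (coordMetric g x (extChartAt (𝓡 n) x x)).IsInvertible)
    (u v : EuclideanSpace ℝ (Fin n)) :
    coordMetric g x (extChartAt (𝓡 n) x x) (christoffel g x u v) = christoffelFirst g x u v := by
  exact hg.self_apply_inverse _

theorem hessian_apply (f : M → ℝ) (x : M) (u v : EuclideanSpace ℝ (Fin n)) :
    hessian g f x u v =
      fderiv ℝ (fderiv ℝ (f ∘ (extChartAt (𝓡 n) x).symm)) (extChartAt (𝓡 n) x x) u v
        - fderiv ℝ (f ∘ (extChartAt (𝓡 n) x).symm) (extChartAt (𝓡 n) x x)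
          (christoffel g x u v) :=
  rfl

/-- `f` is a *convex function* on the Riemannian manifold `(M, g)`: smooth, `∇∇f ≥ 0`. -/
def IsConvexFunction (f : M → ℝ) : Prop :=
  ContMDiff (𝓡 n) 𝓘(ℝ, ℝ) ∞ f ∧ ∀ (x : M) (v : TangentSpace (𝓡 n) x), 0 ≤ hessian g f x v v

/-- `f` is a *strictly convex function* on the Riemannian manifold `(M, g)`: smooth, `∇∇f > 0`. -/
def IsStrictlyConvexFunction (f : M → ℝ) : Prop :=
  ContMDiff (𝓡 n) 𝓘(ℝ, ℝ) ∞ f ∧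
    ∀ (x : M) (v : TangentSpace (𝓡 n) x), v ≠ 0 → 0 < hessian g f x v v

/-- `f` is a *uniformly convex function* on the Riemannian manifold `(M, g)`: smooth, and
`∇∇f ≥ c g` for some constant `c > 0`. -/
def IsUniformlyConvexFunction (f : M → ℝ) : Prop :=
  ContMDiff (𝓡 n) 𝓘(ℝ, ℝ) ∞ f ∧
    ∃ c : ℝ, 0 < c ∧ ∀ (x : M) (v : TangentSpace (𝓡 n) x), c * g x v v ≤ hessian g f x v v

end LeviCivita

/-- `f` is a *spacetime convex function* on the Lorentzian manifold `(M, g)`: it is smooth, its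
Hessian has Lorentzian signature at every point, and `∇∇f ≥ c g` for some constant `c > 0`. -/
def IsSpacetimeConvexFunction {n : ℕ} {M : Type*} [TopologicalSpace M]
    [ChartedSpace (EuclideanSpace ℝ (Fin n)) M] [IsManifold (𝓡 n) ∞ M]
    (g : LorentzianMetric n M) (f : M → ℝ) : Prop :=
  ContMDiff (𝓡 n) 𝓘(ℝ, ℝ) ∞ f ∧
    (∀ x : M, IsLorentzianForm (hessian g.inner f x)) ∧
    ∃ c : ℝ, 0 < c ∧ ∀ (x : M) (v : TangentSpace (𝓡 n) x),
      c * g.inner x v v ≤ hessian g.inner f x v v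

section Hypersurface

variable {n : ℕ} {M : Type*} [TopologicalSpace M]
  [ChartedSpace (EuclideanSpace ℝ (Fin (n + 1))) M] [IsManifold (𝓡 (n + 1)) ∞ M]
  {S : Type*} [TopologicalSpace S] [ChartedSpace (EuclideanSpace ℝ (Fin n)) S]
  (g : LorentzianMetric (n + 1) M) (i : S → M)

/-- The metric `h = i^* g` induced on `S` by a map `i : S → M`. -/
def inducedMetric (x : S) : TangentSpace (𝓡 n) x →L[ℝ] TangentSpace (𝓡 n) x →L[ℝ] ℝ :=
  pullbackForm (g.inner (i x)) (mfderiv (𝓡 n) (𝓡 (n + 1)) i x)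

/-- `i : S → M` is an embedded spacelike hypersurface of `(M, g)`: a smooth embedding whose
induced metric is positive definite. -/
def IsSpacelikeHypersurface : Prop :=
  Manifold.IsSmoothEmbedding (𝓡 n) (𝓡 (n + 1)) ∞ i ∧
    ∀ (x : S) (v : TangentSpace (𝓡 n) x), v ≠ 0 → 0 < inducedMetric g i x v v

/-- `t` is a unit timelike vector at `i x`, normal to the hypersurface `i`. -/
def IsUnitNormal (x : S) (t : TangentSpace (𝓡 (n + 1)) (i x)) : Prop :=
  g.inner (i x) t t = -1 ∧
    ∀ v : TangentSpace (𝓡 n) x, g.inner (i x) t (mfderiv (𝓡 n) (𝓡 (n + 1)) i x v) = 0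

/-- The second fundamental form of the hypersurface `i` at `x`, with respect to a unit normal `t`:
`K(u, v) = g(t, ∇_u (di v))`, where `∇` is the Levi-Civita connection of `g` and, in the charts
around `x` and `i x`, `∇_u (di v) = ∂_u ∂_v i + Γ(di u, di v)`. -/
def secondFundamentalForm (x : S) (t : TangentSpace (𝓡 (n + 1)) (i x))
    (u v : TangentSpace (𝓡 n) x) : ℝ :=
  g.inner (i x) t
    (fderiv ℝ (fderiv ℝ (writtenInExtChartAt (𝓡 n) (𝓡 (n + 1)) x i)) (extChartAt (𝓡 n) x x) u v
      + christoffel g.inner (i x) (mfderiv (𝓡 n) (𝓡 (n + 1)) i x u)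
          (mfderiv (𝓡 n) (𝓡 (n + 1)) i x v))

/-- The hypersurface `i` is *totally geodesic*: its second fundamental form vanishes. -/
def IsTotallyGeodesic : Prop :=
  ∀ (x : S) (t : TangentSpace (𝓡 (n + 1)) (i x)), IsUnitNormal g i x t →
    ∀ u v : TangentSpace (𝓡 n) x, secondFundamentalForm g i x t u v = 0

end Hypersurface

end

/-! By the chain rule, the Hessian of `f ∘ i` is the pullback of the Hessian of `f` plus `df(X)`,
where `X(u, v) = ∇_u (di v) - di(D_u v)` is the defect between the ambient and induced connections.
So everything reduces to `X = 0`.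

The pullback law for Christoffel symbols of the first kind (`koszulForm_fderiv_pullbackForm`) shows
that `X` is orthogonal to the hypersurface (`inner_gauss`). If `X ≠ 0`, it is timelike
(`IsLorentzianForm.neg_of_orthogonal`), so after normalization it is a unit normal. Then `K = 0`
forces `g(X, X) = 0`, a contradiction (`IsTotallyGeodesic.gauss`).

Hence `∇∇f ≥ c g` restricts to `DD(f ∘ i) ≥ c h` with the same `c`, and positivity of `h` gives
strict convexity. -/

open Filter Topology

/-! ### Second-order chain rules in normed spaces -/

section Calculus

variable {E E' F : Type*} [NormedAddCommGroup E] [NormedSpace ℝ E]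
  [NormedAddCommGroup E'] [NormedSpace ℝ E'] [NormedAddCommGroup F] [NormedSpace ℝ F]

/-- The second derivative of a composition. -/
theorem fderiv_fderiv_comp_apply {f : E' → F} {φ : E → E'} {y : E}
    (hf : ContDiffAt ℝ 2 f (φ y)) (hφ : ContDiffAt ℝ 2 φ y) (u v : E) :
    fderiv ℝ (fderiv ℝ (f ∘ φ)) y u v =
      fderiv ℝ (fderiv ℝ f) (φ y) (fderiv ℝ φ y u) (fderiv ℝ φ y v)
        + fderiv ℝ f (φ y) (fderiv ℝ (fderiv ℝ φ) y u v) := by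
  have hfd : ∀ᶠ z in 𝓝 (φ y), DifferentiableAt ℝ f z :=
    (hf.eventually (by simp)).mono fun z hz ↦ hz.differentiableAt (by simp)
  have hφd : ∀ᶠ z in 𝓝 y, DifferentiableAt ℝ φ z :=
    (hφ.eventually (by simp)).mono fun z hz ↦ hz.differentiableAt (by simp)
  have hcomp : fderiv ℝ (f ∘ φ) =ᶠ[𝓝 y] fun z ↦ (fderiv ℝ f (φ z)).comp (fderiv ℝ φ z) := by
    filter_upwards [hφ.continuousAt.eventually hfd, hφd] with z h₁ h₂
    exact fderiv_comp z h₁ h₂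
  have hf' : HasFDerivAt (fderiv ℝ f) (fderiv ℝ (fderiv ℝ f) (φ y)) (φ y) :=
    ((hf.fderiv_right (m := 1) (by norm_num)).differentiableAt (by simp)).hasFDerivAt
  have hφ' : HasFDerivAt (fderiv ℝ φ) (fderiv ℝ (fderiv ℝ φ) y) y :=
    ((hφ.fderiv_right (m := 1) (by norm_num)).differentiableAt (by simp)).hasFDerivAt
  have hd := (hf'.comp y hφd.self_of_nhds.hasFDerivAt).clm_comp hφ'
  rw [hcomp.fderiv_eq]
  erw [hd.fderiv]
  simp [add_comm]

/-- The derivative of the pullback of a field of bilinear forms by a map. -/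
theorem fderiv_pullbackForm_apply {G : E' → E' →L[ℝ] E' →L[ℝ] ℝ} {φ : E → E'} {y : E}
    (hG : DifferentiableAt ℝ G (φ y)) (hφ : ContDiffAt ℝ 2 φ y) (u v w : E) :
    fderiv ℝ (fun z ↦ pullbackForm (G (φ z)) (fderiv ℝ φ z)) y u v w =
      fderiv ℝ G (φ y) (fderiv ℝ φ y u) (fderiv ℝ φ y v) (fderiv ℝ φ y w)
        + G (φ y) (fderiv ℝ (fderiv ℝ φ) y u v) (fderiv ℝ φ y w)
        + G (φ y) (fderiv ℝ φ y v) (fderiv ℝ (fderiv ℝ φ) y u w) := by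
  have hφd : HasFDerivAt φ (fderiv ℝ φ y) y := (hφ.differentiableAt (by simp)).hasFDerivAt
  have hφ' : HasFDerivAt (fderiv ℝ φ) (fderiv ℝ (fderiv ℝ φ) y) y :=
    ((hφ.fderiv_right (m := 1) (by norm_num)).differentiableAt (by simp)).hasFDerivAt
  have hGφ := hG.hasFDerivAt.comp y hφd
  have hP : DifferentiableAt ℝ (fun z ↦ pullbackForm (G (φ z)) (fderiv ℝ φ z)) y := by
    have hpre : DifferentiableAt ℝ
        (fun z ↦ (ContinuousLinearMap.compL ℝ E E' ℝ).flip (fderiv ℝ φ z)) y :=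
      (ContinuousLinearMap.differentiableAt _).comp y hφ'.differentiableAt
    exact hpre.clm_comp (hGφ.differentiableAt.clm_comp hφ'.differentiableAt)
  -- Both compute the derivative of the scalar function `G(φ z)(Dφ v, Dφ w)`; comparing them avoids
  -- differentiating the pullback as an operator.
  have h₁ := (hP.hasFDerivAt.clm_apply (hasFDerivAt_const v y)).clm_apply (hasFDerivAt_const w y)
  have h₂ := (hGφ.clm_apply (hφ'.clm_apply (hasFDerivAt_const v y))).clm_apply
    (hφ'.clm_apply (hasFDerivAt_const w y))
  have h := congrArg (fun L : E →L[ℝ] ℝ ↦ L u) (h₁.unique h₂)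
  simp at h
  rw [h]
  ring

/-- The Koszul form of a pulled back field of symmetric bilinear forms. -/
theorem koszulForm_fderiv_pullbackForm {G : E' → E' →L[ℝ] E' →L[ℝ] ℝ} {φ : E → E'} {y : E}
    (hG : DifferentiableAt ℝ G (φ y)) (hφ : ContDiffAt ℝ 2 φ y)
    (hsymm : ∀ a b, G (φ y) a b = G (φ y) b a) (u v w : E) :
    koszulForm (fderiv ℝ (fun z ↦ pullbackForm (G (φ z)) (fderiv ℝ φ z)) y) u v w =
      koszulForm (fderiv ℝ G (φ y)) (fderiv ℝ φ y u) (fderiv ℝ φ y v) (fderiv ℝ φ y w)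
        + G (φ y) (fderiv ℝ (fderiv ℝ φ) y u v) (fderiv ℝ φ y w) := by
  have hs : ∀ a b, fderiv ℝ (fderiv ℝ φ) y a b = fderiv ℝ (fderiv ℝ φ) y b a :=
    (hφ.isSymmSndFDerivAt (by simp)).eq
  simp only [koszulForm_apply, fderiv_pullbackForm_apply hG hφ]
  -- Symmetry of `D²φ` and of `G` cancels the terms containing `D²φ(u, w)` and `D²φ(v, w)`; the two
  -- in `D²φ(u, v)` add up and absorb the factor 1/2.
  rw [hs v u, hs w u, hs w v, hsymm (fderiv ℝ φ y v) (fderiv ℝ (fderiv ℝ φ) y u w),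
    hsymm (fderiv ℝ φ y u) (fderiv ℝ (fderiv ℝ φ) y v w)]
  ring

end Calculus

/-! ### Linear algebra of Lorentzian forms -/

section LorentzianForm

variable {V W : Type*} [NormedAddCommGroup V] [NormedSpace ℝ V]

theorem isInvertible_of_separatingLeft [FiniteDimensional ℝ V] {B : V →L[ℝ] V →L[ℝ] ℝ}
    (hB : ∀ x, (∀ w, B x w = 0) → x = 0) : B.IsInvertible := by
  have hinj : Function.Injective B.toLinearMap := by
    refine (injective_iff_map_eq_zero _).2 fun x hx ↦ hB x fun w ↦ ?_
    have : B x = 0 := hx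
    simp [this]
  have hdim : Module.finrank ℝ V = Module.finrank ℝ (V →L[ℝ] ℝ) := by
    rw [← (LinearMap.toContinuousLinearMap (𝕜 := ℝ) (E := V) (F' := ℝ)).finrank_eq]
    exact (Subspace.dual_finrank_eq (K := ℝ) (V := V)).symm
  exact ⟨(LinearEquiv.ofInjectiveOfFinrankEq _ hinj hdim).toContinuousLinearEquiv, by ext; rfl⟩

theorem IsLorentzianForm.isInvertible [FiniteDimensional ℝ V] {B : V →L[ℝ] V →L[ℝ] ℝ}
    (hB : IsLorentzianForm B) : B.IsInvertible := by
  obtain ⟨hsymm, v, -, hpos⟩ := hB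
  refine isInvertible_of_separatingLeft fun x hx ↦ ?_
  by_contra h
  have := hpos x h (by rw [hsymm, hx])
  simp [hx] at this

/-- A nonzero vector orthogonal to a spacelike hyperplane is timelike. -/
theorem IsLorentzianForm.neg_of_orthogonal [FiniteDimensional ℝ V]
    [NormedAddCommGroup W] [NormedSpace ℝ W] [FiniteDimensional ℝ W] {B : V →L[ℝ] V →L[ℝ] ℝ} (hB : IsLorentzianForm B) (L : W →L[ℝ] V)
    (hdim : Module.finrank ℝ V = Module.finrank ℝ W + 1)
    (hL : ∀ w, w ≠ 0 → 0 < B (L w) (L w)) {x : V} (hx : x ≠ 0)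
    (horth : ∀ w, B x (L w) = 0) : B x x < 0 := by
  by_contra! hxx
  obtain ⟨hsymm, t, ht, -⟩ := hB
  -- If `x` were not timelike, `B` would be nonnegative on `L(W) + ℝx`. This is all of `V` by
  -- dimension count, so it contains the timelike vector `t`.
  let T : W × ℝ →ₗ[ℝ] V := L.toLinearMap.coprod (LinearMap.toSpanSingleton ℝ V x)
  have hT : ∀ p, T p = L p.1 + p.2 • x := fun p ↦ rfl
  have hquad : ∀ p, B (T p) (T p) = B (L p.1) (L p.1) + p.2 ^ 2 * B x x := by
    intro p
    simp only [hT, map_add, map_smul, add_apply, smul_apply,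
      smul_eq_mul, horth, hsymm (L p.1) x]
    ring
  have hinj : Function.Injective T := by
    refine (injective_iff_map_eq_zero _).2 fun p hp ↦ ?_
    have h0 : p.1 = 0 := by
      by_contra h
      have h₁ := hquad p
      have h₂ := hL _ h
      rw [hp] at h₁
      simp only [map_zero] at h₁
      nlinarith [mul_nonneg (sq_nonneg p.2) hxx]
    have h1 : p.2 • x = 0 := by simpa [hT, h0] using hp
    exact Prod.ext h0 ((smul_eq_zero.1 h1).resolve_right hx)
  have hsurj : Function.Surjective T :=
    (LinearMap.injective_iff_surjective_of_finrank_eq_finrank (by simp [hdim])).1 hinj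
  obtain ⟨p, rfl⟩ := hsurj t
  rw [hquad] at ht
  have h₁ : 0 ≤ B (L p.1) (L p.1) := by
    by_cases h : p.1 = 0
    · simp [h]
    · exact (hL _ h).le
  nlinarith [mul_nonneg (sq_nonneg p.2) hxx]

end LorentzianForm

/-! ### The metric in the preferred charts -/

section Charts

variable {n : ℕ} {M : Type*} [TopologicalSpace M] [ChartedSpace (EuclideanSpace ℝ (Fin n)) M]
  [IsManifold (𝓡 n) ∞ M]

theorem mfderiv_extChartAt_symm_self (x : M) :
    mfderiv (𝓡 n) (𝓡 n) (extChartAt (𝓡 n) x).symm (extChartAt (𝓡 n) x x) =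
      ContinuousLinearMap.id ℝ (EuclideanSpace ℝ (Fin n)) := by
  have : IsManifold (𝓡 n) 1 M := IsManifold.of_le (n := ∞) (by simp)
  have h := mfderivWithin_range_extChartAt_symm (I := 𝓡 n) (x := x)
  rw [(𝓡 n).range_eq_univ, mfderivWithin_univ] at h
  exact h

theorem mdifferentiableAt_extChartAt_symm {x : M} {y : EuclideanSpace ℝ (Fin n)}
    (hy : y ∈ (extChartAt (𝓡 n) x).target) :
    MDifferentiableAt (𝓡 n) (𝓡 n) (extChartAt (𝓡 n) x).symm y := by
  have : IsManifold (𝓡 n) 1 M := IsManifold.of_le (n := ∞) (by simp)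
  have h := mdifferentiableWithinAt_extChartAt_symm (I := 𝓡 n) hy
  rw [(𝓡 n).range_eq_univ, mdifferentiableWithinAt_univ] at h
  exact h

theorem coordMetric_apply_self
    (g : ∀ x : M, TangentSpace (𝓡 n) x →L[ℝ] TangentSpace (𝓡 n) x →L[ℝ] ℝ) (x : M)
    (u v : EuclideanSpace ℝ (Fin n)) :
    coordMetric g x (extChartAt (𝓡 n) x x) u v = g x u v := by
  rw [coordMetric, mfderiv_extChartAt_symm_self, extChartAt_to_inv]
  rfl

theorem LorentzianMetric.isInvertible_coordMetric (g : LorentzianMetric n M) (x : M) :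
    (coordMetric g.inner x (extChartAt (𝓡 n) x x)).IsInvertible := by
  have h : coordMetric g.inner x (extChartAt (𝓡 n) x x) = g.inner x := by
    ext u v
    exact coordMetric_apply_self g.inner x u v
  rw [h]
  exact IsLorentzianForm.isInvertible (V := EuclideanSpace ℝ (Fin n)) (g.lorentzian x)

/-- The components of a Lorentzian metric in a chart are differentiable. -/
theorem LorentzianMetric.differentiableAt_coordMetric (g : LorentzianMetric n M) (x : M) :
    DifferentiableAt ℝ (coordMetric g.inner x) (extChartAt (𝓡 n) x x) := by
  have : IsManifold (𝓡 n) 1 M := IsManifold.of_le (n := ∞) (by simp)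
  have h := ((contMDiffAt_hom_bundle _).1 (g.contMDiff x)).2
  have h₂ := h.comp_of_eq (x := extChartAt (𝓡 n) x x)
    ((contMDiffOn_extChartAt_symm (I := 𝓡 n) x).contMDiffAt (extChartAt_target_mem_nhds x))
    (by simp)
  refine DifferentiableAt.congr_of_eventuallyEq (h₂.contDiffAt.differentiableAt (by simp)) ?_
  -- On the chart target, the inverse of the tangent bundle trivialization is the derivative of the
  -- inverse chart, so the bundle coordinates of `g` are `coordMetric`.
  filter_upwards [extChartAt_target_mem_nhds (I := 𝓡 n) x] with y hy
  ext u v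
  have hs : (extChartAt (𝓡 n) x).symm y ∈ (chartAt (EuclideanSpace ℝ (Fin n)) x).source := by
    simpa using (extChartAt (𝓡 n) x).map_target hy
  have hsymm := TangentBundle.symmL_trivializationAt (I := 𝓡 n) hs
  rw [(𝓡 n).range_eq_univ, mfderivWithin_univ, (extChartAt (𝓡 n) x).right_inv hy] at hsymm
  simp only [Function.comp_apply]
  erw [inCoordinates_apply_eq₂ (by simpa using hs) (by simpa using hs) (by simp)]
  simp only [coordMetric, pullbackForm_apply, ← hsymm]
  rw [Bundle.Trivialization.symmL_apply _ (by simpa using hs),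
    Bundle.Trivialization.symmL_apply _ (by simpa using hs)]
  simp

omit [IsManifold (𝓡 n) ∞ M] in
theorem pullbackForm_mfderiv_congr {m : ℕ}
    (g : ∀ x : M, TangentSpace (𝓡 n) x →L[ℝ] TangentSpace (𝓡 n) x →L[ℝ] ℝ)
    {a b : EuclideanSpace ℝ (Fin m) → M} {y : EuclideanSpace ℝ (Fin m)} (hab : a =ᶠ[𝓝 y] b) :
    pullbackForm (V := EuclideanSpace ℝ (Fin m)) (g (a y)) (mfderiv (𝓡 m) (𝓡 n) a y) =
      pullbackForm (V := EuclideanSpace ℝ (Fin m)) (g (b y)) (mfderiv (𝓡 m) (𝓡 n) b y) := by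
  -- The tangent space depends on the base point, so the equality of points is eliminated with `L`
  -- typed on the model space.
  have h : ∀ (p q : M), p = q → ∀ L : EuclideanSpace ℝ (Fin m) →L[ℝ] EuclideanSpace ℝ (Fin n),
      pullbackForm (W := EuclideanSpace ℝ (Fin n)) (g p) L =
        pullbackForm (W := EuclideanSpace ℝ (Fin n)) (g q) L := by
    rintro p _ rfl L
    rfl
  rw [hab.mfderiv_eq]
  exact h _ _ hab.eq_of_nhds _

end Charts

/-! ### The Gauss formula and restriction of the Hessian -/

section Hypersurface

variable {n : ℕ} {M : Type*} [TopologicalSpace M]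
  [ChartedSpace (EuclideanSpace ℝ (Fin (n + 1))) M]
  {S : Type*} [TopologicalSpace S] [ChartedSpace (EuclideanSpace ℝ (Fin n)) S]
  {i : S → M}

theorem contDiffAt_writtenInExtChartAt (hi : ContMDiff (𝓡 n) (𝓡 (n + 1)) ∞ i) (x : S) :
    ContDiffAt ℝ ∞ (writtenInExtChartAt (𝓡 n) (𝓡 (n + 1)) x i) (extChartAt (𝓡 n) x x) := by
  have h := (contMDiffAt_iff.1 (hi x)).2
  rw [(𝓡 n).range_eq_univ, contDiffWithinAt_univ] at h
  exact h

theorem mfderiv_eq_fderiv_writtenInExtChartAt (hi : ContMDiff (𝓡 n) (𝓡 (n + 1)) ∞ i) (x : S) :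
    mfderiv (𝓡 n) (𝓡 (n + 1)) i x =
      fderiv ℝ (writtenInExtChartAt (𝓡 n) (𝓡 (n + 1)) x i) (extChartAt (𝓡 n) x x) := by
  rw [((hi x).mdifferentiableAt (by simp)).mfderiv, (𝓡 n).range_eq_univ, fderivWithin_univ]

theorem eventually_symm_writtenInExtChartAt (hi : ContMDiff (𝓡 n) (𝓡 (n + 1)) ∞ i) (x : S) :
    (extChartAt (𝓡 (n + 1)) (i x)).symm ∘ writtenInExtChartAt (𝓡 n) (𝓡 (n + 1)) x i
      =ᶠ[𝓝 (extChartAt (𝓡 n) x x)] i ∘ (extChartAt (𝓡 n) x).symm := by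
  have hc : ContinuousAt (i ∘ (extChartAt (𝓡 n) x).symm) (extChartAt (𝓡 n) x x) :=
    hi.continuous.continuousAt.comp (continuousAt_extChartAt_symm x)
  have hs : ∀ᶠ y in 𝓝 (extChartAt (𝓡 n) x x),
      (i ∘ (extChartAt (𝓡 n) x).symm) y ∈ (extChartAt (𝓡 (n + 1)) (i x)).source := by
    refine hc.eventually ?_
    simpa using extChartAt_source_mem_nhds (I := 𝓡 (n + 1)) (i x)
  filter_upwards [hs] with y hy
  exact (extChartAt (𝓡 (n + 1)) (i x)).left_inv hy

variable [IsManifold (𝓡 (n + 1)) ∞ M] [IsManifold (𝓡 n) ∞ S] {g : LorentzianMetric (n + 1) M}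

/-- In charts, the induced metric is the pullback of the ambient metric. -/
theorem coordMetric_inducedMetric_eventuallyEq (hi : ContMDiff (𝓡 n) (𝓡 (n + 1)) ∞ i) (x : S) :
    coordMetric (inducedMetric g i) x =ᶠ[𝓝 (extChartAt (𝓡 n) x x)] fun y ↦
      pullbackForm
        (coordMetric g.inner (i x) (writtenInExtChartAt (𝓡 n) (𝓡 (n + 1)) x i y))
        (fderiv ℝ (writtenInExtChartAt (𝓡 n) (𝓡 (n + 1)) x i) y) := by
  have hφ := contDiffAt_writtenInExtChartAt hi x
  have hφd : ∀ᶠ y in 𝓝 (extChartAt (𝓡 n) x x),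
      DifferentiableAt ℝ (writtenInExtChartAt (𝓡 n) (𝓡 (n + 1)) x i) y :=
    ((hφ.of_le (m := 1) (by simp)).eventually (by simp)).mono
      fun z hz ↦ hz.differentiableAt (by simp)
  have ht : ∀ᶠ y in 𝓝 (extChartAt (𝓡 n) x x),
      writtenInExtChartAt (𝓡 n) (𝓡 (n + 1)) x i y ∈ (extChartAt (𝓡 (n + 1)) (i x)).target := by
    refine hφ.continuousAt.eventually ?_
    simpa [writtenInExtChartAt] using extChartAt_target_mem_nhds (I := 𝓡 (n + 1)) (i x)
  filter_upwards [(eventually_symm_writtenInExtChartAt hi x).eventuallyEq_nhds, hφd, ht,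
    extChartAt_target_mem_nhds (I := 𝓡 n) x] with y hy hd ht hy'
  have h := pullbackForm_mfderiv_congr g.inner hy
  -- The chain rule is applied to both sides of `ψ⁻¹ ∘ φ = i ∘ χ⁻¹`, with `χ`, `ψ` the charts and
  -- `φ` the coordinate form of `i`.
  rw [mfderiv_comp y (mdifferentiableAt_extChartAt_symm ht) hd.mdifferentiableAt,
    mfderiv_comp y (hi.mdifferentiable (by simp) _) (mdifferentiableAt_extChartAt_symm hy'),
    mfderiv_eq_fderiv] at h
  exact h.symm

/-- The Gauss formula: the difference between the ambient covariant derivative and the induced one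
is normal to the hypersurface. -/
theorem inner_gauss (hi : IsSpacelikeHypersurface g i) (x : S)
    (u v w : EuclideanSpace ℝ (Fin n)) {X : EuclideanSpace ℝ (Fin (n + 1))}
    {φ : EuclideanSpace ℝ (Fin n) → EuclideanSpace ℝ (Fin (n + 1))}
    (hφ : φ = writtenInExtChartAt (𝓡 n) (𝓡 (n + 1)) x i) {y : EuclideanSpace ℝ (Fin n)}
    (hy : y = extChartAt (𝓡 n) x x)
    (hX : X = fderiv ℝ (fderiv ℝ φ) y u v
      + christoffel g.inner (i x) (fderiv ℝ φ y u) (fderiv ℝ φ y v)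
      - fderiv ℝ φ y (christoffel (inducedMetric g i) x u v)) :
    g.inner (i x) X (fderiv ℝ φ y w) = 0 := by
  have hic := hi.1.contMDiff
  have hφy : φ y = extChartAt (𝓡 (n + 1)) (i x) (i x) := by
    simp [hφ, hy, writtenInExtChartAt]
  have hφ2 : ContDiffAt ℝ 2 φ y := by
    subst hφ hy
    exact (contDiffAt_writtenInExtChartAt hic x).of_le ENat.LEInfty.out
  have hev : coordMetric (inducedMetric g i) x =ᶠ[𝓝 y] fun z ↦
      pullbackForm (coordMetric g.inner (i x) (φ z)) (fderiv ℝ φ z) := by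
    subst hφ hy
    exact coordMetric_inducedMetric_eventuallyEq hic x
  have hG : DifferentiableAt ℝ (coordMetric g.inner (i x)) (φ y) := by
    rw [hφy]
    exact g.differentiableAt_coordMetric (i x)
  have hGs : ∀ a b, coordMetric g.inner (i x) (φ y) a b = g.inner (i x) a b := by
    intro a b
    rw [hφy]
    exact coordMetric_apply_self g.inner (i x) a b
  have hind : ∀ a b : EuclideanSpace ℝ (Fin n),
      coordMetric (inducedMetric g i) x (extChartAt (𝓡 n) x x) a b =
        coordMetric g.inner (i x) (φ y) (fderiv ℝ φ y a) (fderiv ℝ φ y b) := by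
    intro a b
    rw [← hy, hev.eq_of_nhds, pullbackForm_apply]
  have hinv : (coordMetric (inducedMetric g i) x (extChartAt (𝓡 n) x x)).IsInvertible := by
    refine isInvertible_of_separatingLeft fun a ha ↦ ?_
    by_contra h
    have h' : 0 < coordMetric (inducedMetric g i) x (extChartAt (𝓡 n) x x) a a := by
      rw [coordMetric_apply_self]
      exact hi.2 x a h
    exact h'.ne' (ha a)
  have h₁ := coordMetric_christoffel (inducedMetric g i) x hinv u v
  have h₂ := coordMetric_christoffel g.inner (i x) (g.isInvertible_coordMetric (i x))
    (fderiv ℝ φ y u) (fderiv ℝ φ y v)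
  have hK := koszulForm_fderiv_pullbackForm hG hφ2
    (fun a b ↦ by rw [hGs, hGs]; exact (g.lorentzian (i x)).1 a b) u v w
  rw [← hev.fderiv_eq] at hK
  have h₁' := congrArg (fun L : EuclideanSpace ℝ (Fin n) →L[ℝ] ℝ ↦ L w) h₁
  have h₂' := congrArg
    (fun L : EuclideanSpace ℝ (Fin (n + 1)) →L[ℝ] ℝ ↦ L (fderiv ℝ φ y w)) h₂
  rw [hind] at h₁'
  simp only [christoffelFirst, ← hφy, ← hy] at h₁' h₂'
  -- Lowering the index turns both Christoffel terms into first-kind symbols, and the pullback law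
  -- `hK` makes the sum vanish.
  rw [← hGs, hX]
  simp only [map_add, map_sub, add_apply, sub_apply]
  rw [h₁', h₂', hK]
  ring

/-- On a totally geodesic spacelike hypersurface, the ambient covariant derivative of tangent
fields is the induced one. -/
theorem IsTotallyGeodesic.gauss (hi : IsSpacelikeHypersurface g i) (hK : IsTotallyGeodesic g i)
    (x : S) (u v : EuclideanSpace ℝ (Fin n))
    {φ : EuclideanSpace ℝ (Fin n) → EuclideanSpace ℝ (Fin (n + 1))}
    (hφ : φ = writtenInExtChartAt (𝓡 n) (𝓡 (n + 1)) x i) {y : EuclideanSpace ℝ (Fin n)}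
    (hy : y = extChartAt (𝓡 n) x x) :
    fderiv ℝ (fderiv ℝ φ) y u v
      + christoffel g.inner (i x) (fderiv ℝ φ y u) (fderiv ℝ φ y v)
      = fderiv ℝ φ y (christoffel (inducedMetric g i) x u v) := by
  have hmf : mfderiv (𝓡 n) (𝓡 (n + 1)) i x = fderiv ℝ φ y := by
    subst hφ hy
    exact mfderiv_eq_fderiv_writtenInExtChartAt hi.1.contMDiff x
  let B : EuclideanSpace ℝ (Fin (n + 1)) →L[ℝ] EuclideanSpace ℝ (Fin (n + 1)) →L[ℝ] ℝ :=
    g.inner (i x)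
  have hB : IsLorentzianForm B := g.lorentzian (i x)
  rw [← sub_eq_zero]
  by_contra hX
  set X := fderiv ℝ (fderiv ℝ φ) y u v
      + christoffel g.inner (i x) (fderiv ℝ φ y u) (fderiv ℝ φ y v)
      - fderiv ℝ φ y (christoffel (inducedMetric g i) x u v) with hXdef
  have horth : ∀ w, B X (fderiv ℝ φ y w) = 0 := fun w ↦ inner_gauss hi x u v w hφ hy hXdef
  have hpos : ∀ w, w ≠ 0 → 0 < B (fderiv ℝ φ y w) (fderiv ℝ φ y w) := by
    intro w hw
    have h := hi.2 x w hw
    rw [inducedMetric, hmf] at h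
    exact h
  have hneg : B X X < 0 := hB.neg_of_orthogonal _ (by simp) hpos hX horth
  have hs : 0 < √(-B X X) := Real.sqrt_pos.2 (by linarith)
  have hs2 : √(-B X X) ^ 2 = -B X X := Real.sq_sqrt (by linarith)
  -- `K` is only tested on unit normals, hence the rescaling of `X`.
  have hn : IsUnitNormal g i x ((√(-B X X))⁻¹ • X : EuclideanSpace ℝ (Fin (n + 1))) := by
    constructor
    · change B ((√(-B X X))⁻¹ • X) ((√(-B X X))⁻¹ • X) = -1
      simp only [map_smul, smul_apply, smul_eq_mul]
      have : B X X = -√(-B X X) ^ 2 := by linarith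
      field_simp
      linarith
    · intro w
      rw [hmf]
      change B ((√(-B X X))⁻¹ • X) (fderiv ℝ φ y w) = 0
      simp [horth w]
  have h := hK x _ hn u v
  unfold secondFundamentalForm at h
  rw [hmf, ← hφ, ← hy] at h
  change B ((√(-B X X))⁻¹ • X) (fderiv ℝ (fderiv ℝ φ) y u v
      + christoffel g.inner (i x) (fderiv ℝ φ y u) (fderiv ℝ φ y v)) = 0 at h
  have h' : B X (fderiv ℝ (fderiv ℝ φ) y u v
      + christoffel g.inner (i x) (fderiv ℝ φ y u) (fderiv ℝ φ y v)) = 0 := by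
    simpa [hs.ne'] using h
  -- In the second argument, `X` splits into the ambient derivative, killed by `K = 0`, and a
  -- tangential part, killed by orthogonality.
  have : B X X = 0 := by
    conv_lhs => rw [hXdef, map_sub, ← hXdef]
    rw [h', horth, sub_zero]
  linarith

/-- The Hessian of a function restricted to a totally geodesic spacelike hypersurface is the
restriction of its Hessian. -/
theorem IsTotallyGeodesic.hessian_comp (hi : IsSpacelikeHypersurface g i)
    (hK : IsTotallyGeodesic g i) {f : M → ℝ} (hf : ContMDiff (𝓡 (n + 1)) 𝓘(ℝ, ℝ) ∞ f)
    (x : S) (u v : TangentSpace (𝓡 n) x) :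
    hessian (inducedMetric g i) (f ∘ i) x u v =
      hessian g.inner f (i x) (mfderiv (𝓡 n) (𝓡 (n + 1)) i x u)
        (mfderiv (𝓡 n) (𝓡 (n + 1)) i x v) := by
  change EuclideanSpace ℝ (Fin n) at u v
  have hic := hi.1.contMDiff
  obtain ⟨φ, hφ⟩ : ∃ φ, φ = writtenInExtChartAt (𝓡 n) (𝓡 (n + 1)) x i := ⟨_, rfl⟩
  obtain ⟨y, hy⟩ : ∃ y, y = extChartAt (𝓡 n) x x := ⟨_, rfl⟩
  have hφy : φ y = extChartAt (𝓡 (n + 1)) (i x) (i x) := by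
    simp [hφ, hy, writtenInExtChartAt]
  have hφ2 : ContDiffAt ℝ 2 φ y := by
    subst hφ hy
    exact (contDiffAt_writtenInExtChartAt hic x).of_le ENat.LEInfty.out
  have hmf : mfderiv (𝓡 n) (𝓡 (n + 1)) i x = fderiv ℝ φ y := by
    subst hφ hy
    exact mfderiv_eq_fderiv_writtenInExtChartAt hic x
  have hev : (f ∘ i) ∘ (extChartAt (𝓡 n) x).symm =ᶠ[𝓝 y]
      (f ∘ (extChartAt (𝓡 (n + 1)) (i x)).symm) ∘ φ := by
    subst hφ hy
    exact ((eventually_symm_writtenInExtChartAt hic x).fun_comp f).symm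
  have hF : ContDiffAt ℝ 2 (f ∘ (extChartAt (𝓡 (n + 1)) (i x)).symm) (φ y) := by
    rw [hφy]
    have h := (hf (i x)).comp_of_eq (x := extChartAt (𝓡 (n + 1)) (i x) (i x))
      ((contMDiffOn_extChartAt_symm (I := 𝓡 (n + 1)) (i x)).contMDiffAt
        (extChartAt_target_mem_nhds (i x))) (by simp)
    exact h.contDiffAt.of_le ENat.LEInfty.out
  have hgauss := hK.gauss hi x u v hφ hy
  rw [hmf]
  change fderiv ℝ (fderiv ℝ ((f ∘ i) ∘ (extChartAt (𝓡 n) x).symm)) (extChartAt (𝓡 n) x x) u v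
      - fderiv ℝ ((f ∘ i) ∘ (extChartAt (𝓡 n) x).symm) (extChartAt (𝓡 n) x x)
          (christoffel (inducedMetric g i) x u v)
    = fderiv ℝ (fderiv ℝ (f ∘ (extChartAt (𝓡 (n + 1)) (i x)).symm))
        (extChartAt (𝓡 (n + 1)) (i x) (i x)) (fderiv ℝ φ y u) (fderiv ℝ φ y v)
      - fderiv ℝ (f ∘ (extChartAt (𝓡 (n + 1)) (i x)).symm)
          (extChartAt (𝓡 (n + 1)) (i x) (i x))
          (christoffel g.inner (i x) (fderiv ℝ φ y u) (fderiv ℝ φ y v))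
  -- After `hgauss`, the terms `DF(D²φ(u, v))` from the chain rule and from the induced Christoffel
  -- symbol cancel.
  rw [← hφy, ← hy, hev.fderiv.fderiv_eq, hev.fderiv_eq, fderiv_fderiv_comp_apply hF hφ2,
    fderiv_comp y (hF.differentiableAt (by simp)) (hφ2.differentiableAt (by simp)),
    ContinuousLinearMap.comp_apply, ← hgauss, map_add]
  ring

end Hypersurface

theorem mainTheorem11 {n : ℕ}
    {M : Type*} [TopologicalSpace M] [ChartedSpace (EuclideanSpace ℝ (Fin (n + 1))) M]
    [IsManifold (𝓡 (n + 1)) ∞ M]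
    {S : Type*} [TopologicalSpace S] [ChartedSpace (EuclideanSpace ℝ (Fin n)) S]
    [IsManifold (𝓡 n) ∞ S]
    (g : LorentzianMetric (n + 1) M) (f : M → ℝ) (hf : IsSpacetimeConvexFunction g f)
    (i : S → M) (hi : IsSpacelikeHypersurface g i) (hK : IsTotallyGeodesic g i) :
    IsConvexFunction (inducedMetric g i) (f ∘ i) ∧
      IsStrictlyConvexFunction (inducedMetric g i) (f ∘ i) ∧
      IsUniformlyConvexFunction (inducedMetric g i) (f ∘ i) := by
  obtain ⟨hfs, -, c, hc, hcf⟩ := hf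
  have hfi := hfs.comp hi.1.contMDiff
  have hunif : ∀ (x : S) (v : TangentSpace (𝓡 n) x),
      c * inducedMetric g i x v v ≤ hessian (inducedMetric g i) (f ∘ i) x v v := by
    intro x v
    rw [hK.hessian_comp hi hfs]
    exact hcf (i x) (mfderiv (𝓡 n) (𝓡 (n + 1)) i x v)
  have hstrict : ∀ (x : S) (v : TangentSpace (𝓡 n) x), v ≠ 0 →
      0 < hessian (inducedMetric g i) (f ∘ i) x v v :=
    fun x v hv ↦ (mul_pos hc (hi.2 x v hv)).trans_le (hunif x v)
  refine ⟨⟨hfi, fun x v ↦ ?_⟩, ⟨hfi, hstrict⟩, hfi, c, hc, hunif⟩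
  by_cases hv : v = 0
  · simp [hv]
  · exact (hstrict x v hv).le
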